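/- Let $0<\varepsilon<1/2$. There is $A_0=A_0(\varepsilon)>0$ such that for every $A\ge A_0$ there is a constant $C=C(\varepsilon,A)>0$ with the following property. Let $n\ge 2$ be an integer and let $w_1,\dots,w_n$ be real numbers such that 1. (non-degeneracy) $\sum_{i=1}^n w_i=0$, $\sum_{i=1}^n w_i^2=1$, and $|w_i-w_j|\le \dfrac{1}{A\sqrt{\log n}}$ for all $i\ne j$; 2. no interval of length $\varepsilon/\sqrt n$ contains $w_i$ for more than $(1-\varepsilon)n$ indices $i$; 3. there are at least $A\,n\log n$ ordered pairs $(i,j)\in\{1,\dots,n\}^2$ with $\dfrac{1}{n^{3/2}}\le |w_i-w_j|\le \dfrac{1}{n^{3/2-\varepsilon}}$. Then, for a uniformly random permutation $\pi$ of $\{1,\dots,n\}$ and every $L\in\mathbb R$, $$\mathbb P\Big(\Big|\sum_{i=1}^n w_i\,\frac{\pi(i)}{n}-L\Big|\le \frac{1}{n^{5/2-\varepsilon}}\Big)\le \frac{C}{n^{5/2-\varepsilon}}.$$ -/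

import Mathlib

open scoped Nat

noncomputable section

namespace PermSum

/-- A real sequence `w` of length `n` is non-degenerate with constant `A`: it is a unit vector
orthogonal to the all-ones vector, and any two of its entries differ by at most
`1 / (A √(log n))`. -/
structure NonDegenerate (A : ℝ) {n : ℕ} (w : Fin n → ℝ) : Prop where
  sum_eq_zero : ∑ i, w i = 0
  sum_sq_eq_one : ∑ i, w i ^ 2 = 1
  abs_sub_le : ∀ i j, i ≠ j → |w i - w j| ≤ 1 / (A * Real.sqrt (Real.log n))

/-- No interval of length `ℓ` contains more than `m` of the values of `w`, counted with
multiplicity. (It is enough to speak of closed intervals, since any interval of length `ℓ` lies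
in a closed one of the same length.) -/
def NoConcentration (ℓ m : ℝ) {n : ℕ} (w : Fin n → ℝ) : Prop :=
  ∀ a : ℝ, (Nat.card {i : Fin n // w i ∈ Set.Icc a (a + ℓ)} : ℝ) ≤ m

/-- The number of (ordered) pairs of indices `(i, j)` with `lo ≤ |w i - w j| ≤ hi`. -/
def pairCount (lo hi : ℝ) {n : ℕ} (w : Fin n → ℝ) : ℕ :=
  Nat.card {p : Fin n × Fin n // lo ≤ |w p.1 - w p.2| ∧ |w p.1 - w p.2| ≤ hi}

/-- The sum `∑ i, w i * v (π i)` attached to a permutation `π`. -/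
def permSum {n : ℕ} (w v : Fin n → ℝ) (π : Equiv.Perm (Fin n)) : ℝ :=
  ∑ i, w i * v (π i)

/-- The sequence `1/n, 2/n, …, n/n`; as `Fin n` is `{0, …, n - 1}`, the index is shifted by one. -/
def linearSeq (n : ℕ) (i : Fin n) : ℝ := ((i : ℕ) + 1 : ℝ) / n

/-- The probability that a uniformly random permutation of `n` indices satisfies `E`. -/
def permProb (n : ℕ) (E : Equiv.Perm (Fin n) → Prop) : ℝ :=
  (Nat.card {π : Equiv.Perm (Fin n) // E π} : ℝ) / (n ! : ℝ)

end PermSum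

end

noncomputable section

namespace PermSum

/-! Fourier inversion. With `S = permSum w (linearSeq n) π`, `T = n ^ (5/2 - ε)` and `φ(t) = 𝔼
exp(itS)`, a smoothing inequality (`card_near_le`) reduces the claim to `|φ(t)| = O(exp(-ct²) +
1/T)` for `0 < t ≤ T`.

To bound `φ`, average over the swap of two positions `i, j`. This produces a factor `cos(t (w i - w
j)(π i - π j) / (2n))` and replaces `w i`, `w j` by their mean. Averaged over `π j`, the modulus of
the cosine is at most `1 - κ²/480` as soon as `2κ ≤ |t (w i - w j)| ≤ n` and `κ ≤ 1`. Over `m`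
disjoint such pairs the gains multiply (`norm_sum_exp_le_pow`); a set of `4mn` admissible ordered
pairs contains such a matching when `96m ≤ n`.

For `t` up to order `n ^ (3/2)`, non-concentration and the unit norm supply order `n²` pairs with
difference of order `1/√n`, so `m` is of order `n` and the decay is Gaussian down to `exp(-cn)`. For
larger `t`, the pairs of the third hypothesis allow `m` of order `log n`, or of order `n` if that is
smaller, giving `n⁻³ + exp(-cn)`, which is `O(1/T)`. -/

/-! ### Averages of `|cos (θ (a - b))|` over nearly full sets of residues -/

lemma sum_range_sub_sq (x : ℝ) (n : ℕ) :
    ∑ b ∈ Finset.range n, (x - b) ^ 2 =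
      n * (x - ((n : ℝ) - 1) / 2) ^ 2 + n * ((n : ℝ) ^ 2 - 1) / 12 := by
  induction n with
  | zero => simp
  | succ k ih =>
    rw [Finset.sum_range_succ, ih]
    push_cast
    ring

/-- Multiplied by `sin θ`, the sum telescopes (Dirichlet kernel). -/
lemma abs_sum_range_cos_le (y θ : ℝ) (n : ℕ) :
    |Real.sin θ| * |∑ b ∈ Finset.range n, Real.cos (y - 2 * θ * b)| ≤ 1 := by
  have h : Real.sin θ * ∑ b ∈ Finset.range n, Real.cos (y - 2 * θ * b) =
      (Real.sin (y + θ) - Real.sin (y + θ - 2 * θ * n)) / 2 := by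
    induction n with
    | zero => simp
    | succ k ih =>
      rw [Finset.sum_range_succ, mul_add, ih]
      have e1 : y + θ - 2 * θ * k = (y - 2 * θ * k) + θ := by ring
      have e2 : y + θ - 2 * θ * ((k + 1 : ℕ) : ℝ) = (y - 2 * θ * k) - θ := by
        push_cast; ring
      rw [e1, e2, Real.sin_add (y - 2 * θ * k), Real.sin_sub (y - 2 * θ * k)]
      ring
  rw [← abs_mul, h, abs_le]
  have h1 := Real.sin_le_one (y + θ)
  have h2 := Real.neg_one_le_sin (y + θ)
  have h3 := Real.sin_le_one (y + θ - 2 * θ * n)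
  have h4 := Real.neg_one_le_sin (y + θ - 2 * θ * n)
  constructor <;> linarith

lemma two_div_pi_mul_abs_le_abs_sin {x : ℝ} (hx : |x| ≤ Real.pi / 2) :
    2 / Real.pi * |x| ≤ |Real.sin x| := by
  have h := Real.mul_le_sin (abs_nonneg x) hx
  rcases abs_cases x with ⟨e, _⟩ | ⟨e, _⟩
  · rw [e] at h ⊢; exact h.trans (le_abs_self _)
  · rw [e] at h ⊢
    rw [Real.sin_neg] at h
    exact h.trans (neg_le_abs _)

lemma sq_div_ten_le_sin_sq {x : ℝ} (hx : |x| ≤ 2) : x ^ 2 / 10 ≤ Real.sin x ^ 2 := by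
  have hp := Real.pi_gt_three
  have hp' := Real.pi_lt_d4
  have hy : |x / 2| ≤ 1 := by rw [abs_div, abs_two]; linarith
  have h1 := two_div_pi_mul_abs_le_abs_sin (x := x / 2) (by linarith)
  have h2 : 1 / 2 ≤ Real.cos (x / 2) := by
    have := Real.one_sub_sq_div_two_le_cos (x := x / 2)
    have h3 : (x / 2) ^ 2 ≤ 1 := by rw [← sq_abs]; exact pow_le_one₀ (abs_nonneg _) hy
    linarith
  have h4 : (0.636 : ℝ) ≤ 2 / Real.pi := by
    rw [le_div_iff₀ Real.pi_pos]; linarith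
  have h5 : 0.636 * |x / 2| ≤ |Real.sin (x / 2)| :=
    (mul_le_mul_of_nonneg_right h4 (abs_nonneg _)).trans h1
  have h6 : (0.636 * |x / 2|) ^ 2 ≤ Real.sin (x / 2) ^ 2 := by
    rw [← sq_abs (Real.sin (x / 2))]
    exact pow_le_pow_left₀ (by positivity) h5 2
  have h7 : (1 / 2 : ℝ) ^ 2 ≤ Real.cos (x / 2) ^ 2 := pow_le_pow_left₀ (by norm_num) h2 2
  have e : Real.sin x = 2 * Real.sin (x / 2) * Real.cos (x / 2) := by
    rw [← Real.sin_two_mul]; ring_nf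
  rw [e]
  rw [mul_pow, sq_abs] at h6
  have h8 := mul_le_mul h6 h7 (by positivity) (by positivity)
  nlinarith [sq_nonneg x]

/-- Over a nearly full set of residues, `sin² (θ (a - b))` is not small on average. -/
lemma le_sum_sin_sq {n : ℕ} (hn : 2 ≤ n) (R : Finset (Fin n)) (hR : 47 * n ≤ 48 * R.card)
    (a : Fin n) {θ κ : ℝ} (hθ : |θ| ≤ 1 / 2) (hκ : 0 ≤ κ) (hκ1 : κ ≤ 1) (hκθ : κ ≤ n * |θ|) :
    n * κ ^ 2 / 240 ≤ ∑ b ∈ R, Real.sin (θ * ((a : ℕ) - (b : ℕ) : ℝ)) ^ 2 := by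
  have hn2 : (2 : ℝ) ≤ n := by exact_mod_cast hn
  have hsplit : ∀ f : Fin n → ℝ, ∑ b ∈ R, f b = ∑ b, f b - ∑ b ∈ Rᶜ, f b := by
    intro f; rw [← Finset.sum_add_sum_compl R f]; ring
  have hRc : ((Rᶜ).card : ℝ) ≤ n / 48 := by
    have h := Finset.card_compl_add_card R
    rw [Fintype.card_fin] at h
    have : 48 * (Rᶜ).card ≤ n := by omega
    have : (48 : ℝ) * (Rᶜ).card ≤ n := by exact_mod_cast this
    linarith
  have hab : ∀ b : Fin n, |((a : ℕ) - (b : ℕ) : ℝ)| ≤ n := by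
    intro b
    have h1 : ((a : ℕ) : ℝ) ≤ n := by exact_mod_cast a.2.le
    have h2 : ((b : ℕ) : ℝ) ≤ n := by exact_mod_cast b.2.le
    have h3 : (0 : ℝ) ≤ (a : ℕ) := Nat.cast_nonneg _
    have h4 : (0 : ℝ) ≤ (b : ℕ) := Nat.cast_nonneg _
    rw [abs_le]; constructor <;> linarith
  -- If `n|θ| ≤ 2`, all arguments lie in `[-2, 2]`, where `sin²` is comparable to the square.
  -- Otherwise the sines oscillate, and the Dirichlet kernel bound shows that `sin²` has average at
  -- least `1/10` over all residues. In both cases the at most `n/48` missing residues are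
  -- affordable.
  rcases le_total ((n : ℝ) * |θ|) 2 with hs | hl
  · have h1 : ∀ b ∈ R, θ ^ 2 / 10 * ((a : ℕ) - (b : ℕ) : ℝ) ^ 2 ≤
        Real.sin (θ * ((a : ℕ) - (b : ℕ) : ℝ)) ^ 2 := by
      intro b _
      have : |θ * ((a : ℕ) - (b : ℕ) : ℝ)| ≤ 2 := by
        rw [abs_mul]
        calc |θ| * _ ≤ |θ| * n := mul_le_mul_of_nonneg_left (hab b) (abs_nonneg _)
          _ ≤ 2 := by linarith
      have h := sq_div_ten_le_sin_sq this
      rw [mul_pow] at h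
      linarith
    refine le_trans ?_ (Finset.sum_le_sum h1)
    rw [← Finset.mul_sum, hsplit,
      Fin.sum_univ_eq_sum_range (fun b : ℕ => ((a : ℕ) - (b : ℝ)) ^ 2) n, sum_range_sub_sq]
    have h2 : ∑ b ∈ Rᶜ, ((a : ℕ) - (b : ℕ) : ℝ) ^ 2 ≤ n / 48 * (n : ℝ) ^ 2 := by
      calc _ ≤ ∑ b ∈ Rᶜ, (n : ℝ) ^ 2 := by
            refine Finset.sum_le_sum fun b _ => ?_
            rw [← sq_abs]
            exact pow_le_pow_left₀ (abs_nonneg _) (hab b) 2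
        _ = (Rᶜ).card * (n : ℝ) ^ 2 := by simp
        _ ≤ _ := mul_le_mul_of_nonneg_right hRc (by positivity)
    have h3 : (n : ℝ) ^ 3 / 24 ≤ n * (((a : ℕ) : ℝ) - ((n : ℝ) - 1) / 2) ^ 2 +
        n * ((n : ℝ) ^ 2 - 1) / 12 - ∑ b ∈ Rᶜ, ((a : ℕ) - (b : ℕ) : ℝ) ^ 2 := by
      have : 0 ≤ (n : ℝ) * (((a : ℕ) : ℝ) - ((n : ℝ) - 1) / 2) ^ 2 := by positivity
      have h5 : (n : ℝ) * 4 ≤ n * (n : ℝ) ^ 2 :=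
        mul_le_mul_of_nonneg_left (by nlinarith) (by linarith)
      nlinarith
    have h4 : κ ^ 2 ≤ (n : ℝ) ^ 2 * θ ^ 2 := by
      rw [← sq_abs θ, ← mul_pow]; exact pow_le_pow_left₀ hκ hκθ 2
    calc n * κ ^ 2 / 240 ≤ n * ((n : ℝ) ^ 2 * θ ^ 2) / 240 := by gcongr
      _ = θ ^ 2 / 10 * ((n : ℝ) ^ 3 / 24) := by ring
      _ ≤ _ := mul_le_mul_of_nonneg_left h3 (by positivity)
  · have hp := Real.pi_gt_three
    have hp' := Real.pi_lt_d2
    have h1 := abs_sum_range_cos_le (2 * θ * (a : ℕ)) θ n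
    set S := ∑ b ∈ Finset.range n, Real.cos (2 * θ * (a : ℕ) - 2 * θ * b) with hS
    have h2 : 1.25 ≤ n * |Real.sin θ| := by
      have h3 := two_div_pi_mul_abs_le_abs_sin (x := θ) (by linarith)
      have h4 : (0.63 : ℝ) ≤ 2 / Real.pi := by
        rw [le_div_iff₀ Real.pi_pos]; linarith
      have h5 : 0.63 * |θ| ≤ |Real.sin θ| :=
        (mul_le_mul_of_nonneg_right h4 (abs_nonneg _)).trans h3
      nlinarith
    have h3 : |S| ≤ 0.8 * n := by
      have h0 := abs_nonneg S
      have : 1.25 * |S| ≤ n * (|Real.sin θ| * |S|) := by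
        rw [← mul_assoc]; exact mul_le_mul_of_nonneg_right h2 h0
      nlinarith
    have h4 : ∑ b : Fin n, Real.sin (θ * ((a : ℕ) - (b : ℕ) : ℝ)) ^ 2 = n / 2 - S / 2 := by
      rw [hS, Fin.sum_univ_eq_sum_range
        (fun b : ℕ => Real.sin (θ * ((a : ℕ) - (b : ℝ))) ^ 2) n]
      have : ∀ b ∈ Finset.range n, Real.sin (θ * ((a : ℕ) - (b : ℝ))) ^ 2 =
          1 / 2 - Real.cos (2 * θ * (a : ℕ) - 2 * θ * b) / 2 := by
        intro b _
        rw [Real.sin_sq_eq_half_sub]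
        ring_nf
      rw [Finset.sum_congr rfl this, Finset.sum_sub_distrib, Finset.sum_const,
        Finset.card_range, nsmul_eq_mul, ← Finset.sum_div]
      ring
    have h5 : ∑ b ∈ Rᶜ, Real.sin (θ * ((a : ℕ) - (b : ℕ) : ℝ)) ^ 2 ≤ n / 48 := by
      calc _ ≤ ∑ b ∈ Rᶜ, (1 : ℝ) := Finset.sum_le_sum fun b _ => Real.sin_sq_le_one _
        _ ≤ _ := by simpa using hRc
    rw [hsplit, h4]
    have h6 : κ ^ 2 ≤ 1 := pow_le_one₀ hκ hκ1
    have h7 := (abs_le.1 h3).2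
    have h8 : (n : ℝ) * κ ^ 2 ≤ n * 1 := mul_le_mul_of_nonneg_left h6 (by linarith)
    linarith

/-- This is `2|cos x| ≤ 1 + cos² x`. -/
lemma abs_cos_le_one_sub_sin_sq (x : ℝ) : |Real.cos x| ≤ 1 - Real.sin x ^ 2 / 2 := by
  have := Real.sin_sq_add_cos_sq x
  rw [← sq_abs (Real.cos x)] at this
  nlinarith [sq_nonneg (|Real.cos x| - 1)]

/-- The same estimate for the average of `|cos (θ (a - b))|` over `b ≠ a`. -/
lemma sum_abs_cos_le {n : ℕ} (hn : 2 ≤ n) (R : Finset (Fin n)) (hR : 47 * n ≤ 48 * R.card)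
    {a : Fin n} (ha : a ∈ R) {θ κ : ℝ} (hθ : |θ| ≤ 1 / 2) (hκ : 0 ≤ κ) (hκ1 : κ ≤ 1)
    (hκθ : κ ≤ n * |θ|) :
    ∑ b ∈ R.erase a, |Real.cos (θ * ((a : ℕ) - (b : ℕ) : ℝ))| ≤
      (1 - κ ^ 2 / 480) * (R.erase a).card := by
  have h1 := le_sum_sin_sq hn R hR a hθ hκ hκ1 hκθ
  rw [← Finset.add_sum_erase R _ ha] at h1
  simp only [sub_self, mul_zero, Real.sin_zero, ne_eq, OfNat.ofNat_ne_zero, not_false_eq_true,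
    zero_pow, zero_add] at h1
  have h2 : ((R.erase a).card : ℝ) ≤ n := by
    have := Finset.card_le_univ (R.erase a)
    rw [Fintype.card_fin] at this
    exact_mod_cast this
  calc _ ≤ ∑ b ∈ R.erase a, (1 - Real.sin (θ * ((a : ℕ) - (b : ℕ) : ℝ)) ^ 2 / 2) :=
        Finset.sum_le_sum fun b _ => abs_cos_le_one_sub_sin_sq _
    _ = (R.erase a).card - (∑ b ∈ R.erase a, Real.sin (θ * ((a : ℕ) - (b : ℕ) : ℝ)) ^ 2) / 2 := by
        rw [Finset.sum_sub_distrib, ← Finset.sum_div]; simp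
    _ ≤ _ := by nlinarith [mul_le_mul_of_nonneg_right h2 (sq_nonneg κ)]

/-! ### Gaining a factor from each swapped pair -/

open Equiv in
lemma permSum_mul_swap {n : ℕ} (w v : Fin n → ℝ) (π : Perm (Fin n)) {i j : Fin n} (hij : i ≠ j) :
    permSum w v (π * swap i j) = permSum w v π - (w i - w j) * (v (π i) - v (π j)) := by
  unfold permSum
  have hj : j ∈ Finset.univ.erase i := by simp [hij.symm]
  rw [← Finset.add_sum_erase _ _ (Finset.mem_univ i), ← Finset.add_sum_erase _ _ hj,
    ← Finset.add_sum_erase _ (fun k => w k * v (π k)) (Finset.mem_univ i),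
    ← Finset.add_sum_erase _ (fun k => w k * v (π k)) hj]
  have : ∀ k ∈ (Finset.univ.erase i).erase j,
      w k * v ((π * swap i j) k) = w k * v (π k) := by
    intro k hk
    simp only [Finset.mem_erase] at hk
    rw [Perm.mul_apply, swap_apply_of_ne_of_ne hk.2.1 hk.1]
  rw [Finset.sum_congr rfl this]
  simp only [Perm.mul_apply, swap_apply_left, swap_apply_right]
  ring

/-- The weights `w` with `w i` and `w j` replaced by their mean. -/
def pairMean {n : ℕ} (w : Fin n → ℝ) (i j : Fin n) (k : Fin n) : ℝ :=
  if k = i ∨ k = j then (w i + w j) / 2 else w k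

lemma permSum_pairMean {n : ℕ} (w v : Fin n → ℝ) (π : Equiv.Perm (Fin n)) {i j : Fin n}
    (hij : i ≠ j) :
    permSum (pairMean w i j) v π = permSum w v π - (w i - w j) * (v (π i) - v (π j)) / 2 := by
  unfold permSum
  have hj : j ∈ Finset.univ.erase i := by simp [hij.symm]
  rw [← Finset.add_sum_erase _ _ (Finset.mem_univ i), ← Finset.add_sum_erase _ _ hj,
    ← Finset.add_sum_erase _ (fun k => w k * v (π k)) (Finset.mem_univ i),
    ← Finset.add_sum_erase _ (fun k => w k * v (π k)) hj]
  have : ∀ k ∈ (Finset.univ.erase i).erase j,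
      pairMean w i j k * v (π k) = w k * v (π k) := by
    intro k hk
    simp only [Finset.mem_erase] at hk
    simp [pairMean, hk.1, hk.2.1]
  rw [Finset.sum_congr rfl this]
  simp only [pairMean, true_or, or_true, if_true]
  ring

lemma exp_add_exp_sub (s d : ℝ) :
    Complex.exp ((s : ℂ) * Complex.I) + Complex.exp (((s - 2 * d : ℝ) : ℂ) * Complex.I) =
      2 * (Real.cos d : ℂ) * Complex.exp (((s - d : ℝ) : ℂ) * Complex.I) := by
  rw [Complex.ofReal_cos, Complex.two_cos, add_mul, ← Complex.exp_add, ← Complex.exp_add]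
  congr 2 <;> push_cast <;> ring_nf

/-- Averaging over the position of the second argument. -/
lemma sum_mul_le_of_swap_invariant {n : ℕ} (U : Finset (Fin n)) {i j : Fin n} (hi : i ∈ U)
    (hj : j ∈ U) (hij : i ≠ j) (c : Equiv.Perm (Fin n) → ℝ) (hc0 : ∀ π, 0 ≤ c π)
    (hc : ∀ a ∈ U, ∀ b ∈ U, ∀ π, c (π * Equiv.swap a b) = c π) (g : Fin n → Fin n → ℝ) (ρ : ℝ)
    (hg : ∀ R : Finset (Fin n), R.card = U.card → ∀ a ∈ R,
      ∑ b ∈ R.erase a, g a b ≤ ρ * (R.erase a).card) :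
    ∑ π, c π * g (π i) (π j) ≤ ρ * ∑ π, c π := by
  have hjU : j ∈ U.erase i := Finset.mem_erase.2 ⟨hij.symm, hj⟩
  have hpos : (0 : ℝ) < (U.erase i).card := by exact_mod_cast Finset.card_pos.2 ⟨j, hjU⟩
  -- Reindexing by the swap of `j` and `b` leaves `c` unchanged, so `j` may be replaced by an
  -- average over `b`. For fixed `π` the value `π b` then runs over the image of `U` without `π i`.
  have h1 : ∀ b ∈ U.erase i, ∑ π, c π * g (π i) (π j) = ∑ π, c π * g (π i) (π b) := by
    intro b hb
    obtain ⟨hbi, hbU⟩ := Finset.mem_erase.1 hb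
    rw [← Equiv.sum_comp (Equiv.mulRight (Equiv.swap j b))]
    refine Finset.sum_congr rfl fun π _ => ?_
    simp only [Equiv.coe_mulRight, hc j hj b hbU, Equiv.Perm.mul_apply, Equiv.swap_apply_left,
      Equiv.swap_apply_of_ne_of_ne hij hbi.symm]
  have h2 : (U.erase i).card * ∑ π, c π * g (π i) (π j) =
      ∑ π, c π * ∑ b ∈ U.erase i, g (π i) (π b) := by
    rw [← nsmul_eq_mul, ← Finset.sum_const, Finset.sum_congr rfl h1, Finset.sum_comm]
    simp only [Finset.mul_sum]
  have h3 : ∀ π : Equiv.Perm (Fin n),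
      ∑ b ∈ U.erase i, g (π i) (π b) ≤ ρ * (U.erase i).card := by
    intro π
    have h := hg (U.map π.toEmbedding) (Finset.card_map _) (π i)
      (Finset.mem_map_of_mem π.toEmbedding hi)
    have e : (U.map π.toEmbedding).erase (π i) = (U.erase i).map π.toEmbedding :=
      (Finset.map_erase π.toEmbedding U i).symm
    rw [e, Finset.sum_map, Finset.card_map] at h
    exact h
  have h4 : (U.erase i).card * ∑ π, c π * g (π i) (π j) ≤
      (U.erase i).card * (ρ * ∑ π, c π) := by
    rw [h2]
    calc _ ≤ ∑ π, c π * (ρ * (U.erase i).card) :=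
          Finset.sum_le_sum fun π _ => mul_le_mul_of_nonneg_left (h3 π) (hc0 π)
      _ = _ := by rw [← Finset.sum_mul]; ring
  exact le_of_mul_le_mul_left h4 hpos

lemma card_inter_erase_erase {n : ℕ} (E : Finset (Fin n × Fin n)) (U : Finset (Fin n))
    (i j : Fin n) :
    (E ∩ U ×ˢ U).card ≤
      (E ∩ ((U.erase i).erase j) ×ˢ ((U.erase i).erase j)).card + 4 * n := by
  have hsub : E ∩ U ×ˢ U ⊆ (E ∩ ((U.erase i).erase j) ×ˢ ((U.erase i).erase j)) ∪
      ({i, j} ×ˢ Finset.univ ∪ Finset.univ ×ˢ {i, j}) := by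
    rintro ⟨a, b⟩ h
    simp only [Finset.mem_inter, Finset.mem_product, Finset.mem_union, Finset.mem_erase,
      Finset.mem_insert, Finset.mem_singleton, Finset.mem_univ] at h ⊢
    tauto
  have h2 : (({i, j} : Finset (Fin n))).card ≤ 2 := Finset.card_le_two
  calc _ ≤ _ := Finset.card_le_card hsub
    _ ≤ _ := Finset.card_union_le _ _
    _ ≤ _ := by
      gcongr
      refine (Finset.card_union_le _ _).trans ?_
      rw [Finset.card_product, Finset.card_product, Finset.card_univ, Fintype.card_fin]
      nlinarith

/-- Exponential sums over permutations gain a factor for each pair of a matching in `E`, which is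
built greedily inside the set `U` of indices not used so far. -/
lemma norm_sum_exp_le_pow {n : ℕ} (hn : 2 ≤ n) {t κ : ℝ} (hκ : 0 < κ) (hκ1 : κ ≤ 1)
    (E : Finset (Fin n × Fin n)) (m : ℕ) :
    ∀ (w : Fin n → ℝ) (U : Finset (Fin n)) (c : Equiv.Perm (Fin n) → ℂ),
      47 * n + 96 * m ≤ 48 * U.card → 4 * m * n ≤ (E ∩ U ×ˢ U).card →
      (∀ i ∈ U, ∀ j ∈ U, (i, j) ∈ E → 2 * κ ≤ |t * (w i - w j)| ∧ |t * (w i - w j)| ≤ n) →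
      (∀ i ∈ U, ∀ j ∈ U, ∀ π, c (π * Equiv.swap i j) = c π) →
      ‖∑ π, c π * Complex.exp (((t * permSum w (linearSeq n) π : ℝ) : ℂ) * Complex.I)‖ ≤
        (1 - κ ^ 2 / 480) ^ m * ∑ π, ‖c π‖ := by
  have hn0 : (0 : ℝ) < n := by exact_mod_cast (by omega : 0 < n)
  have hρ : 0 ≤ 1 - κ ^ 2 / 480 := by nlinarith
  induction m with
  | zero =>
    intro w U c _ _ _ _
    rw [pow_zero, one_mul]
    refine (norm_sum_le _ _).trans (Finset.sum_le_sum fun π _ => ?_)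
    rw [norm_mul, Complex.norm_exp_ofReal_mul_I, mul_one]
  | succ m ih =>
    -- A step removes two indices from `U`, costing `96 = 48 * 2` in `hU`, and loses at most `4n`
    -- pairs of `E`. The coefficient `c` collects the cosines so far; they involve only used
    -- indices, hence its invariance under swaps inside `U`.
    intro w U c hU hE hw hc
    obtain ⟨⟨i, j⟩, hp⟩ : (E ∩ U ×ˢ U).Nonempty := by
      rw [← Finset.card_pos]
      exact lt_of_lt_of_le (by positivity) hE
    simp only [Finset.mem_inter, Finset.mem_product] at hp
    obtain ⟨hijE, hi, hj⟩ := hp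
    obtain ⟨hlo, hhi⟩ := hw i hi j hj hijE
    have hij : i ≠ j := by
      rintro rfl
      simp at hlo
      linarith
    set U' := (U.erase i).erase j with hU'
    have hmem : ∀ a ∈ U', a ≠ i ∧ a ≠ j ∧ a ∈ U := by
      intro a ha
      simp only [hU', Finset.mem_erase] at ha
      tauto
    have hcard : U'.card + 2 = U.card := by
      have hjU : j ∈ U.erase i := Finset.mem_erase.2 ⟨hij.symm, hj⟩
      have h1 := Finset.card_erase_add_one hi
      have h2 := Finset.card_erase_add_one hjU
      rw [hU']
      omega
    set θ : ℝ := t * (w i - w j) / (2 * n) with hθ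
    set g : Fin n → Fin n → ℝ := fun x y => Real.cos (θ * ((x : ℕ) - (y : ℕ) : ℝ)) with hg
    set c' : Equiv.Perm (Fin n) → ℂ := fun π => c π * (g (π i) (π j) : ℂ) with hc'
    have hd : ∀ π : Equiv.Perm (Fin n),
        θ * (((π i : Fin n) : ℕ) - ((π j : Fin n) : ℕ) : ℝ) =
          t * ((w i - w j) * (linearSeq n (π i) - linearSeq n (π j)) / 2) := by
      intro π
      rw [hθ]
      unfold linearSeq
      field_simp
      ring
    have hsum : ∑ π, c π * Complex.exp (((t * permSum w (linearSeq n) π : ℝ) : ℂ) * Complex.I) =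
        ∑ π, c' π * Complex.exp
          (((t * permSum (pairMean w i j) (linearSeq n) π : ℝ) : ℂ) * Complex.I) := by
      -- Twice the sum is the sum plus its reindexing by the swap of `i` and `j`; the two
      -- exponentials combine into a cosine times the exponential at the mean weights.
      have h2 : (2 : ℂ) ≠ 0 := two_ne_zero
      apply mul_left_cancel₀ h2
      rw [two_mul]
      nth_rewrite 2 [← Equiv.sum_comp (Equiv.mulRight (Equiv.swap i j))]
      rw [← Finset.sum_add_distrib, Finset.mul_sum]
      refine Finset.sum_congr rfl fun π _ => ?_
      simp only [Equiv.coe_mulRight, hc i hi j hj, hc', hg]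
      rw [permSum_mul_swap _ _ _ hij, permSum_pairMean _ _ _ hij, ← mul_add, hd]
      have h := exp_add_exp_sub (t * permSum w (linearSeq n) π)
        (t * ((w i - w j) * (linearSeq n (π i) - linearSeq n (π j)) / 2))
      have e1 : t * (permSum w (linearSeq n) π -
          (w i - w j) * (linearSeq n (π i) - linearSeq n (π j))) =
          t * permSum w (linearSeq n) π -
            2 * (t * ((w i - w j) * (linearSeq n (π i) - linearSeq n (π j)) / 2)) := by ring
      rw [e1, h, mul_sub]
      ring_nf
    have hIH := ih (pairMean w i j) U' c' (by omega)
      (by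
        have := card_inter_erase_erase E U i j
        rw [← hU'] at this
        nlinarith)
      (by
        intro a ha b hb hab
        obtain ⟨ha1, ha2, ha3⟩ := hmem a ha
        obtain ⟨hb1, hb2, hb3⟩ := hmem b hb
        simpa [pairMean, ha1, ha2, hb1, hb2] using hw a ha3 b hb3 hab)
      (by
        intro a ha b hb π
        obtain ⟨ha1, ha2, ha3⟩ := hmem a ha
        obtain ⟨hb1, hb2, hb3⟩ := hmem b hb
        simp only [hc', hc a ha3 b hb3, Equiv.Perm.mul_apply,
          Equiv.swap_apply_of_ne_of_ne ha1.symm hb1.symm,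
          Equiv.swap_apply_of_ne_of_ne ha2.symm hb2.symm])
    have hθabs : |θ| = |t * (w i - w j)| / (2 * n) := by
      rw [hθ, abs_div, abs_of_pos (by positivity : (0 : ℝ) < 2 * n)]
    have hc'le : ∑ π, ‖c' π‖ ≤ (1 - κ ^ 2 / 480) * ∑ π, ‖c π‖ := by
      have h := sum_mul_le_of_swap_invariant U hi hj hij (fun π => ‖c π‖)
        (fun _ => norm_nonneg _) (fun a ha b hb π => by rw [hc a ha b hb])
        (fun x y => |g x y|) (1 - κ ^ 2 / 480)
        (fun R hR a ha => sum_abs_cos_le hn R (by omega) ha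
          (by rw [hθabs, div_le_iff₀ (by positivity)]; linarith) hκ.le hκ1
          (by rw [hθabs, ← mul_div_assoc, le_div_iff₀ (by positivity)]; nlinarith))
      refine le_trans (le_of_eq ?_) h
      refine Finset.sum_congr rfl fun π _ => ?_
      simp only [hc', norm_mul, Complex.norm_real, Real.norm_eq_abs]
    rw [hsum]
    refine hIH.trans ?_
    rw [pow_succ (1 - κ ^ 2 / 480) m, mul_assoc]
    exact mul_le_mul_of_nonneg_left hc'le (pow_nonneg hρ m)

/-- The characteristic function of a permutation sum decays exponentially in the number of
pairs of weights whose difference, multiplied by `t`, lies between `2 κ` and `n`. -/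
lemma norm_sum_exp_le_exp {n : ℕ} (hn : 2 ≤ n) {t κ : ℝ} (hκ : 0 < κ) (hκ1 : κ ≤ 1)
    (w : Fin n → ℝ) (E : Finset (Fin n × Fin n)) (m : ℕ) (hm : 96 * m ≤ n)
    (hE : 4 * m * n ≤ E.card)
    (hw : ∀ i j, (i, j) ∈ E → 2 * κ ≤ |t * (w i - w j)| ∧ |t * (w i - w j)| ≤ n) :
    ‖∑ π, Complex.exp (((t * permSum w (linearSeq n) π : ℝ) : ℂ) * Complex.I)‖ ≤
      n ! * Real.exp (-(κ ^ 2 * m / 480)) := by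
  have h := norm_sum_exp_le_pow hn hκ hκ1 E m w Finset.univ (fun _ => 1)
    (by rw [Finset.card_univ, Fintype.card_fin]; omega)
    (by rwa [Finset.univ_product_univ, Finset.inter_univ])
    (fun i _ j _ hij => hw i j hij) (fun _ _ _ _ _ => rfl)
  simp only [one_mul, norm_one, Finset.sum_const, Finset.card_univ, Fintype.card_perm,
    Fintype.card_fin, nsmul_eq_mul, mul_one] at h
  refine h.trans ?_
  rw [mul_comm]
  refine mul_le_mul_of_nonneg_left ?_ (Nat.cast_nonneg _)
  have h1 : 1 - κ ^ 2 / 480 ≤ Real.exp (-(κ ^ 2 / 480)) := by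
    have := Real.add_one_le_exp (-(κ ^ 2 / 480))
    linarith
  calc (1 - κ ^ 2 / 480) ^ m ≤ Real.exp (-(κ ^ 2 / 480)) ^ m :=
        pow_le_pow_left₀ (by nlinarith) h1 m
    _ = _ := by rw [← Real.exp_nat_mul]; congr 1; ring

/-! ### Smoothing with a Fejér kernel -/

lemma integral_hat_mul_cos {x : ℝ} (hx : x ≠ 0) :
    ∫ s in (0 : ℝ)..1, (1 - s) * Real.cos (s * x) = (1 - Real.cos x) / x ^ 2 := by
  have hd : ∀ s ∈ Set.uIcc (0 : ℝ) 1, HasDerivAt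
      (fun s => (1 - s) * Real.sin (s * x) / x - Real.cos (s * x) / x ^ 2)
      ((1 - s) * Real.cos (s * x)) s := by
    intro s _
    have h0 : HasDerivAt (fun s : ℝ => s * x) x s := by
      simpa using (hasDerivAt_id s).mul_const x
    have h1 : HasDerivAt (fun s : ℝ => 1 - s) (-1) s := by
      simpa using (hasDerivAt_id s).const_sub 1
    have h2 := ((h1.mul h0.sin).div_const x).sub (h0.cos.div_const (x ^ 2))
    refine h2.congr_deriv ?_
    field_simp
    ring
  rw [intervalIntegral.integral_eq_sub_of_hasDerivAt hd
    (Continuous.intervalIntegrable (by fun_prop) _ _)]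
  simp
  ring

/-- Positivity, together with the lower bound `1/4` on `[-1, 1]`, makes four times this kernel a
majorant of the indicator of `[-1, 1]`, whose transform has compact support. -/
lemma integral_hat_mul_cos_nonneg (x : ℝ) :
    0 ≤ ∫ s in (0 : ℝ)..1, (1 - s) * Real.cos (s * x) := by
  rcases eq_or_ne x 0 with rfl | hx
  · refine intervalIntegral.integral_nonneg zero_le_one fun s hs => ?_
    simpa using hs.2
  · rw [integral_hat_mul_cos hx]
    have := Real.cos_le_one x
    exact div_nonneg (by linarith) (sq_nonneg x)

lemma quarter_le_integral_hat_mul_cos {x : ℝ} (hx : |x| ≤ 1) :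
    1 / 4 ≤ ∫ s in (0 : ℝ)..1, (1 - s) * Real.cos (s * x) := by
  have h : ∫ s in (0 : ℝ)..1, (1 - s) * (1 / 2 : ℝ) = 1 / 4 := by
    rw [intervalIntegral.integral_mul_const, intervalIntegral.integral_sub (by simp) (by simp)]
    simp
    norm_num
  rw [← h]
  refine intervalIntegral.integral_mono_on zero_le_one
    (Continuous.intervalIntegrable (by fun_prop) _ _)
    (Continuous.intervalIntegrable (by fun_prop) _ _) fun s hs => ?_
  refine mul_le_mul_of_nonneg_left ?_ (by linarith [hs.2])
  have h1 := Real.one_sub_sq_div_two_le_cos (x := s * x)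
  have h2 : |s * x| ≤ 1 := by
    rw [abs_mul, abs_of_nonneg hs.1]
    exact mul_le_one₀ hs.2 (abs_nonneg x) hx
  have h3 : (s * x) ^ 2 ≤ 1 := by rw [← sq_abs]; exact pow_le_one₀ (abs_nonneg _) h2
  linarith

lemma sum_cos_sub_le_norm {ι : Type*} [Fintype ι] (X : ι → ℝ) (y : ℝ) :
    ∑ a, Real.cos (X a - y) ≤ ‖∑ a, Complex.exp ((X a : ℂ) * Complex.I)‖ := by
  have h : ∑ a, Real.cos (X a - y) =
      (Complex.exp (((-y : ℝ) : ℂ) * Complex.I) *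
        ∑ a, Complex.exp ((X a : ℂ) * Complex.I)).re := by
    rw [Finset.mul_sum, Complex.re_sum]
    refine Finset.sum_congr rfl fun a _ => ?_
    rw [← Complex.exp_add, ← add_mul, ← Complex.ofReal_add, Complex.exp_ofReal_mul_I_re]
    ring_nf
  rw [h]
  refine (Complex.re_le_norm _).trans ?_
  rw [norm_mul, Complex.norm_exp_ofReal_mul_I, one_mul]

/-- A smoothing inequality of Esseen type for a finite family of reals. -/
lemma card_near_le {ι : Type*} [Fintype ι] (X : ι → ℝ) (L : ℝ) {T N c B : ℝ} (hT : 0 < T)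
    (hN : 0 ≤ N) (hc : 0 < c) (hB : 0 ≤ B)
    (hX : ∀ t : ℝ, 0 < t → t ≤ T → ‖∑ a, Complex.exp (((t * X a : ℝ) : ℂ) * Complex.I)‖ ≤
      N * (Real.exp (-c * t ^ 2) + B / T)) :
    (Nat.card {a : ι // |X a - L| ≤ 1 / T} : ℝ) ≤
      N * ((2 * Real.sqrt (Real.pi / c) + 4 * B) * (1 / T)) := by
  classical
  set k : ℝ → ℝ := fun x => ∫ s in (0 : ℝ)..1, (1 - s) * Real.cos (s * x) with hk
  have h1 : (Nat.card {a : ι // |X a - L| ≤ 1 / T} : ℝ) * (1 / 4) ≤ ∑ a, k (T * (X a - L)) := by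
    rw [Nat.card_eq_fintype_card, Fintype.card_subtype, ← nsmul_eq_mul, ← Finset.sum_const]
    refine (Finset.sum_le_sum fun a ha => ?_).trans
      (Finset.sum_le_univ_sum_of_nonneg fun a => integral_hat_mul_cos_nonneg _)
    refine quarter_le_integral_hat_mul_cos ?_
    rw [abs_mul, abs_of_pos hT]
    have := (Finset.mem_filter.1 ha).2
    rwa [le_div_iff₀ hT, mul_comm] at this
  have h2 : ∑ a, k (T * (X a - L)) =
      ∫ s in (0 : ℝ)..1, (1 - s) * ∑ a, Real.cos (s * (T * (X a - L))) := by
    simp only [hk]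
    rw [← intervalIntegral.integral_finsetSum fun a _ =>
      Continuous.intervalIntegrable (by fun_prop) _ _]
    simp only [Finset.mul_sum]
  have h3 : ∫ s in (0 : ℝ)..1, (1 - s) * ∑ a, Real.cos (s * (T * (X a - L))) ≤
      ∫ s in (0 : ℝ)..1, N * (Real.exp (-(c * T ^ 2) * s ^ 2) + B / T) := by
    -- The open interval suffices and avoids `t = 0`, where `hX` says nothing; here `t = s * T`.
    refine intervalIntegral.integral_mono_on_of_le_Ioo zero_le_one
      (Continuous.intervalIntegrable (by fun_prop) _ _)
      (Continuous.intervalIntegrable (by fun_prop) _ _) fun s hs => ?_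
    have h := hX (s * T) (mul_pos hs.1 hT) (by nlinarith [hs.2])
    have h' := sum_cos_sub_le_norm (fun a => s * T * X a) (s * T * L)
    have e : ∀ a, s * T * X a - s * T * L = s * (T * (X a - L)) := fun a => by ring
    simp only [e] at h'
    have e2 : -c * (s * T) ^ 2 = -(c * T ^ 2) * s ^ 2 := by ring
    rw [e2] at h
    have h4 := h'.trans h
    have h5 : 0 ≤ N * (Real.exp (-(c * T ^ 2) * s ^ 2) + B / T) := by positivity
    calc _ ≤ (1 - s) * (N * (Real.exp (-(c * T ^ 2) * s ^ 2) + B / T)) :=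
          mul_le_mul_of_nonneg_left h4 (by linarith [hs.2])
      _ ≤ _ := by nlinarith [hs.1, mul_nonneg hs.1.le h5]
  have hcT : 0 < c * T ^ 2 := by positivity
  have h4 : ∫ s in (0 : ℝ)..1, Real.exp (-(c * T ^ 2) * s ^ 2) ≤
      Real.sqrt (Real.pi / c) / 2 * (1 / T) := by
    rw [intervalIntegral.integral_of_le zero_le_one]
    have h5 : ∫ s in Set.Ioc (0 : ℝ) 1, Real.exp (-(c * T ^ 2) * s ^ 2) ≤
        ∫ s in Set.Ioi (0 : ℝ), Real.exp (-(c * T ^ 2) * s ^ 2) :=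
      MeasureTheory.setIntegral_mono_set (integrable_exp_neg_mul_sq hcT).integrableOn
        (Filter.Eventually.of_forall fun s => (Real.exp_pos _).le)
        Set.Ioc_subset_Ioi_self.eventuallyLE
    refine h5.trans (le_of_eq ?_)
    rw [integral_gaussian_Ioi, ← div_div, Real.sqrt_div' _ (sq_nonneg T), Real.sqrt_sq hT.le]
    ring
  have h5 : ∫ s in (0 : ℝ)..1, N * (Real.exp (-(c * T ^ 2) * s ^ 2) + B / T) =
      N * ((∫ s in (0 : ℝ)..1, Real.exp (-(c * T ^ 2) * s ^ 2)) + B / T) := by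
    rw [intervalIntegral.integral_const_mul, intervalIntegral.integral_add
      (Continuous.intervalIntegrable (by fun_prop) _ _) (by simp)]
    simp
  have h6 : N * ((∫ s in (0 : ℝ)..1, Real.exp (-(c * T ^ 2) * s ^ 2)) + B / T) ≤
      N * (Real.sqrt (Real.pi / c) / 2 * (1 / T) + B / T) := by gcongr
  have h7 : N * ((2 * Real.sqrt (Real.pi / c) + 4 * B) * (1 / T)) =
      4 * (N * (Real.sqrt (Real.pi / c) / 2 * (1 / T) + B / T)) := by ring
  rw [h7]
  rw [h2] at h1
  linarith

/-! ### Pairs of weights at distance of order `1/√n` -/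

lemma NonDegenerate.two_le {A : ℝ} {n : ℕ} {w : Fin n → ℝ} (h : NonDegenerate A w) : 2 ≤ n := by
  have h1 := h.sum_eq_zero
  have h2 := h.sum_sq_eq_one
  match n, w, h1, h2 with
  | 0, w, _, h2 => simp at h2
  | 1, w, h1, h2 =>
    simp at h1 h2
    rw [h1] at h2
    norm_num at h2
  | n + 2, _, _, _ => omega

lemma NonDegenerate.sum_sub_sq {A : ℝ} {n : ℕ} {w : Fin n → ℝ} (h : NonDegenerate A w) :
    ∑ i, ∑ j, (w i - w j) ^ 2 = 2 * n := by
  have h1 : ∀ i, ∑ j, (w i - w j) ^ 2 = n * w i ^ 2 + 1 := by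
    intro i
    have : ∀ j, (w i - w j) ^ 2 = w i ^ 2 - 2 * w i * w j + w j ^ 2 := fun j => by ring
    simp only [this]
    rw [Finset.sum_add_distrib, Finset.sum_sub_distrib, ← Finset.mul_sum, h.sum_eq_zero,
      h.sum_sq_eq_one]
    simp
  simp only [h1]
  rw [Finset.sum_add_distrib, ← Finset.mul_sum, h.sum_sq_eq_one]
  simp
  ring

/-- The ordered pairs of indices whose weights differ by an amount between `lo` and `hi`. -/
def pairSet {n : ℕ} (lo hi : ℝ) (w : Fin n → ℝ) : Finset (Fin n × Fin n) :=
  Finset.univ.filter fun p => lo ≤ |w p.1 - w p.2| ∧ |w p.1 - w p.2| ≤ hi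

lemma mem_pairSet {n : ℕ} {lo hi : ℝ} {w : Fin n → ℝ} {i j : Fin n} :
    (i, j) ∈ pairSet lo hi w ↔ lo ≤ |w i - w j| ∧ |w i - w j| ≤ hi := by
  simp [pairSet]

lemma card_pairSet {n : ℕ} (lo hi : ℝ) (w : Fin n → ℝ) :
    (pairSet lo hi w).card = pairCount lo hi w := by
  rw [pairCount, Nat.card_eq_fintype_card, Fintype.card_subtype, pairSet]

/-- A positive proportion of the pairs of weights differ by an amount of order `1 / √n`. -/
lemma le_card_pairSet {A ε : ℝ} (hε : 0 < ε) {n : ℕ} {w : Fin n → ℝ} (h : NonDegenerate A w)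
    (hc : NoConcentration (ε / √n) ((1 - ε) * n) w) :
    ε * n ^ 2 / 2 ≤ ((pairSet (ε / (2 * √n)) (2 / √ε / √n) w).card : ℝ) := by
  classical
  have hn0 : (0 : ℝ) < n := by exact_mod_cast (by linarith [h.two_le] : 0 < n)
  have hq : 0 < √(n : ℝ) := Real.sqrt_pos.2 hn0
  have hq2 : √(n : ℝ) ^ 2 = n := Real.sq_sqrt hn0.le
  have he : 0 < √ε := Real.sqrt_pos.2 hε
  have he2 : √ε ^ 2 = ε := Real.sq_sqrt hε.le
  set near : Fin n → Fin n → ℝ := fun i j =>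
    if w j ∈ Set.Icc (w i - ε / (2 * √n)) (w i - ε / (2 * √n) + ε / √n) then 1 else 0 with hnear
  set mid : Fin n → Fin n → ℝ := fun i j =>
    if ε / (2 * √n) ≤ |w i - w j| ∧ |w i - w j| ≤ 2 / √ε / √n then 1 else 0 with hmid
  -- A pair is near, intermediate, or far; far pairs are paid for by Chebyshev. Summed over all
  -- pairs, near ones contribute at most `(1 - ε)n²` and the quadratic term `εn²/2`, which leaves
  -- `εn²/2` for the intermediate ones.
  have hpt : ∀ i j, 1 ≤ near i j + mid i j + (w i - w j) ^ 2 * (ε * n / 4) := by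
    intro i j
    have hs : 0 ≤ (w i - w j) ^ 2 * (ε * n / 4) := by positivity
    have hn1 : 0 ≤ near i j := by simp only [hnear]; split_ifs <;> norm_num
    have hm1 : 0 ≤ mid i j := by simp only [hmid]; split_ifs <;> norm_num
    by_cases h1 : |w i - w j| < ε / (2 * √n)
    · have : near i j = 1 := by
        simp only [hnear]
        rw [if_pos]
        have e : ε / √n = ε / (2 * √n) + ε / (2 * √n) := by field_simp; ring
        rw [abs_lt] at h1
        rw [Set.mem_Icc, e]
        constructor <;> linarith
      linarith
    · by_cases h2 : |w i - w j| ≤ 2 / √ε / √n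
      · have : mid i j = 1 := by
          simp only [hmid]
          rw [if_pos ⟨not_lt.1 h1, h2⟩]
        linarith
      · have h3 : (2 / √ε / √n) ^ 2 ≤ (w i - w j) ^ 2 := by
          rw [← sq_abs (w i - w j)]
          exact pow_le_pow_left₀ (by positivity) (not_le.1 h2).le 2
        have h4 : (2 / √ε / √n) ^ 2 * (ε * n / 4) = 1 := by
          rw [div_pow, div_pow, he2, hq2]
          field_simp
          norm_num
        have h5 := mul_le_mul_of_nonneg_right h3 (by positivity : 0 ≤ ε * n / 4)
        linarith
  have hnearsum : ∀ i, ∑ j, near i j ≤ (1 - ε) * n := by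
    intro i
    have := hc (w i - ε / (2 * √n))
    rw [Nat.card_eq_fintype_card, Fintype.card_subtype] at this
    simpa [hnear] using this
  have hmidsum : ∑ i, ∑ j, mid i j = ((pairSet (ε / (2 * √n)) (2 / √ε / √n) w).card : ℝ) := by
    rw [pairSet, Finset.card_filter, Nat.cast_sum, Fintype.sum_prod_type]
    simp [hmid]
  have hsum : ∑ _i : Fin n, ∑ _j : Fin n, (1 : ℝ) ≤
      ∑ i, ∑ j, (near i j + mid i j + (w i - w j) ^ 2 * (ε * n / 4)) :=
    Finset.sum_le_sum fun i _ => Finset.sum_le_sum fun j _ => hpt i j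
  simp only [Finset.sum_add_distrib, ← Finset.sum_mul] at hsum
  rw [h.sum_sub_sq, hmidsum] at hsum
  have h6 : ∑ i, ∑ j, near i j ≤ n * ((1 - ε) * n) := by
    refine (Finset.sum_le_sum fun i _ => hnearsum i).trans (le_of_eq ?_)
    simp
  simp at hsum
  nlinarith

/-! ### The characteristic function in the two frequency ranges -/

lemma exp_neg_min_le (x y : ℝ) : Real.exp (-min x y) ≤ Real.exp (-x) + Real.exp (-y) := by
  have h1 := Real.exp_pos (-x)
  have h2 := Real.exp_pos (-y)
  rcases min_choice x y with h | h <;> rw [h] <;> linarith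

lemma exp_neg_mul_le {a x : ℝ} (ha : 0 < a) (hx : 0 < x) :
    Real.exp (-(a * x)) ≤ 6 / a ^ 3 / x ^ 3 := by
  have h := Real.pow_div_factorial_le_exp (a * x) (by positivity) 3
  rw [Real.exp_neg, div_div, ← mul_pow, inv_le_comm₀ (Real.exp_pos _) (by positivity)]
  refine le_trans (le_of_eq ?_) h
  rw [inv_div]
  norm_num [Nat.factorial]

/-- Rounding the number of pairs down costs at most a factor `e < 3`. -/
lemma exp_neg_floor_le {κ x : ℝ} (hκ : 0 ≤ κ) (hκ1 : κ ≤ 1) :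
    Real.exp (-(κ ^ 2 * ⌊x⌋₊ / 480)) ≤ 3 * Real.exp (-(κ ^ 2 * x / 480)) := by
  have h1 : x - 1 ≤ ⌊x⌋₊ := (Nat.sub_one_lt_floor x).le
  have h2 : κ ^ 2 ≤ 1 := pow_le_one₀ hκ hκ1
  have h3 : -(κ ^ 2 * ⌊x⌋₊ / 480) ≤ 1 + -(κ ^ 2 * x / 480) := by
    have := mul_le_mul_of_nonneg_left h1 (sq_nonneg κ)
    linarith
  calc _ ≤ Real.exp (1 + -(κ ^ 2 * x / 480)) := Real.exp_le_exp.2 h3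
    _ = Real.exp 1 * Real.exp (-(κ ^ 2 * x / 480)) := Real.exp_add _ _
    _ ≤ _ := mul_le_mul_of_nonneg_right (by linarith [Real.exp_one_lt_d9]) (Real.exp_pos _).le

/-- The characteristic function at frequencies up to order `n ^ (3 / 2)`. -/
lemma norm_sum_exp_le_of_le {A ε : ℝ} (hε : 0 < ε) (hε' : ε < 1 / 2) {n : ℕ} {w : Fin n → ℝ}
    (h : NonDegenerate A w) (hc : NoConcentration (ε / √n) ((1 - ε) * n) w) {t : ℝ} (ht : 0 < t)
    (htn : t * (2 / √ε) ≤ n * √n) :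
    ‖∑ π, Complex.exp (((t * permSum w (linearSeq n) π : ℝ) : ℂ) * Complex.I)‖ ≤
      n ! * (3 * (Real.exp (-(ε ^ 3 / 737280 * t ^ 2)) + Real.exp (-(ε / 46080 * n)))) := by
  have hn0 : (0 : ℝ) < n := by exact_mod_cast (by linarith [h.two_le] : 0 < n)
  have hq : 0 < √(n : ℝ) := Real.sqrt_pos.2 hn0
  have hq2 : √(n : ℝ) ^ 2 = n := Real.sq_sqrt hn0.le
  -- Half of `t` times the least difference `ε / (2√n)`, capped at `1`. With `m` about `εn/96`, the
  -- exponent `κ²m/480` gives `737280 = 16 * 96 * 480` and `46080 = 96 * 480`.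
  set κ : ℝ := min 1 (t * ε / (4 * √n)) with hκdef
  have hκ : 0 < κ := lt_min one_pos (by positivity)
  have hκ1 : κ ≤ 1 := min_le_left _ _
  have hfl : (⌊ε * n / 96⌋₊ : ℝ) ≤ ε * n / 96 := Nat.floor_le (by positivity)
  have hmain := norm_sum_exp_le_exp h.two_le (t := t) hκ hκ1 w
    (pairSet (ε / (2 * √n)) (2 / √ε / √n) w) ⌊ε * n / 96⌋₊
    (by
      have : (96 : ℝ) * ⌊ε * n / 96⌋₊ ≤ n := by nlinarith
      exact_mod_cast this)
    (by
      have h1 := le_card_pairSet hε h hc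
      have : (4 : ℝ) * ⌊ε * n / 96⌋₊ * n ≤
          ((pairSet (ε / (2 * √n)) (2 / √ε / √n) w).card : ℝ) := by
        refine le_trans ?_ h1
        have := mul_le_mul_of_nonneg_right hfl hn0.le
        nlinarith [mul_pos (mul_pos hε hn0) hn0]
      exact_mod_cast this)
    (by
      intro i j hij
      rw [mem_pairSet] at hij
      rw [abs_mul, abs_of_pos ht]
      constructor
      · calc 2 * κ ≤ 2 * (t * ε / (4 * √n)) := by
              gcongr
              exact min_le_right _ _
          _ = t * (ε / (2 * √n)) := by field_simp; norm_num
          _ ≤ _ := mul_le_mul_of_nonneg_left hij.1 ht.le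
      · calc _ ≤ t * (2 / √ε / √n) := mul_le_mul_of_nonneg_left hij.2 ht.le
          _ = t * (2 / √ε) / √n := by ring
          _ ≤ n := by rwa [div_le_iff₀ hq])
  refine hmain.trans (mul_le_mul_of_nonneg_left ?_ (Nat.cast_nonneg _))
  refine (exp_neg_floor_le hκ.le hκ1).trans (mul_le_mul_of_nonneg_left ?_ (by norm_num))
  have h2 : κ ^ 2 * (ε * n / 96) / 480 =
      min (ε ^ 3 / 737280 * t ^ 2) (ε / 46080 * n) := by
    have h3 : κ ^ 2 = min 1 ((t * ε / (4 * √n)) ^ 2) := by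
      rcases le_total 1 (t * ε / (4 * √n)) with h4 | h4
      · rw [hκdef, min_eq_left h4, min_eq_left (one_le_pow₀ h4), one_pow]
      · rw [hκdef, min_eq_right h4, min_eq_right (pow_le_one₀ (by positivity) h4)]
    rw [h3, mul_div_assoc, min_mul_of_nonneg _ _ (by positivity), min_comm]
    congr 1
    · rw [div_pow, mul_pow, mul_pow, hq2]
      field_simp
      norm_num
    · ring
  rw [h2]
  exact exp_neg_min_le _ _

/-- The characteristic function at frequencies from order `n ^ (3 / 2)` to `n ^ (5 / 2 - ε)`. -/
lemma norm_sum_exp_le_of_ge {A ε : ℝ} (hε : 0 < ε) (hε' : ε < 1 / 2) {n : ℕ} {w : Fin n → ℝ}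
    (hn : 2 ≤ n) (hA : 92160 / ε ≤ A)
    (hp : A * n * Real.log n ≤
      (pairCount (1 / (n : ℝ) ^ (3 / 2 : ℝ)) (1 / (n : ℝ) ^ (3 / 2 - ε)) w : ℝ)) {t : ℝ}
    (ht : t ≤ (n : ℝ) ^ (5 / 2 - ε)) (htn : n * √n ≤ t * (2 / √ε)) :
    ‖∑ π, Complex.exp (((t * permSum w (linearSeq n) π : ℝ) : ℂ) * Complex.I)‖ ≤
      n ! * (3 * (1 / (n : ℝ) ^ 3 + Real.exp (-(ε / 737280 * n)))) := by
  have hn0 : (0 : ℝ) < n := by exact_mod_cast (by linarith : 0 < n)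
  have hq : 0 < √(n : ℝ) := Real.sqrt_pos.2 hn0
  have he : 0 < √ε := Real.sqrt_pos.2 hε
  have he2 : √ε ^ 2 = ε := Real.sq_sqrt hε.le
  have ht0 : 0 < t := by
    by_contra hcon
    have h1 : t * (2 / √ε) ≤ 0 := mul_nonpos_of_nonpos_of_nonneg (not_lt.1 hcon) (by positivity)
    have h2 : 0 < (n : ℝ) * √n := by positivity
    linarith
  have hlog : 0 ≤ Real.log n := Real.log_natCast_nonneg n
  have hκ1 : √ε / 4 ≤ 1 := by
    have : √ε ≤ 1 := Real.sqrt_le_one.2 (by linarith)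
    linarith
  have hpow : (n : ℝ) ^ (3 / 2 : ℝ) = n * √n := by
    rw [Real.sqrt_eq_rpow, ← Real.rpow_one_add' hn0.le (by norm_num)]
    norm_num
  -- With `κ = √ε/4` the first entry makes `κ²x/480` equal to `3 log n`; the second keeps the
  -- matching within `n/96` pairs.
  set x : ℝ := min (23040 / ε * Real.log n) (n / 96) with hx
  have hx0 : 0 ≤ x := le_min (by positivity) (by positivity)
  have hfl : (⌊x⌋₊ : ℝ) ≤ x := Nat.floor_le hx0
  have hmain := norm_sum_exp_le_exp hn (t := t) (by positivity) hκ1 w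
    (pairSet (1 / (n : ℝ) ^ (3 / 2 : ℝ)) (1 / (n : ℝ) ^ (3 / 2 - ε)) w) ⌊x⌋₊
    (by
      have h1 : x ≤ n / 96 := min_le_right _ _
      have : (96 : ℝ) * ⌊x⌋₊ ≤ n := by linarith
      exact_mod_cast this)
    (by
      rw [card_pairSet]
      have h1 : x ≤ 23040 / ε * Real.log n := min_le_left _ _
      have : (4 : ℝ) * ⌊x⌋₊ * n ≤
          (pairCount (1 / (n : ℝ) ^ (3 / 2 : ℝ)) (1 / (n : ℝ) ^ (3 / 2 - ε)) w : ℝ) := by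
        refine le_trans ?_ hp
        calc (4 : ℝ) * ⌊x⌋₊ * n ≤ 4 * (23040 / ε * Real.log n) * n := by
              gcongr
              exact hfl.trans h1
          _ = 92160 / ε * n * Real.log n := by ring
          _ ≤ _ := by gcongr
      exact_mod_cast this)
    (by
      intro i j hij
      rw [mem_pairSet] at hij
      rw [abs_mul, abs_of_pos ht0]
      constructor
      · refine le_trans ?_ (mul_le_mul_of_nonneg_left hij.1 ht0.le)
        rw [hpow, mul_one_div, le_div_iff₀ (by positivity)]
        have h1 := mul_le_mul_of_nonneg_right htn (by positivity : 0 ≤ √ε / 2)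
        have h2 : t * (2 / √ε) * (√ε / 2) = t := by field_simp
        linarith
      · refine (mul_le_mul ht hij.2 (abs_nonneg _) (by positivity)).trans (le_of_eq ?_)
        rw [mul_one_div, ← Real.rpow_sub hn0]
        norm_num)
  refine hmain.trans (mul_le_mul_of_nonneg_left ?_ (Nat.cast_nonneg _))
  refine (exp_neg_floor_le (by positivity) hκ1).trans
    (mul_le_mul_of_nonneg_left ?_ (by norm_num))
  have h2 : (√ε / 4) ^ 2 * x / 480 = min (3 * Real.log n) (ε / 737280 * n) := by
    rw [hx, mul_div_right_comm, mul_min_of_nonneg _ _ (by positivity), div_pow, he2]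
    congr 1
    · field_simp
      ring
    · ring
  have h3 : Real.exp (-(3 * Real.log n)) = 1 / (n : ℝ) ^ 3 := by
    rw [Real.exp_neg, one_div, mul_comm, ← Real.rpow_natCast (n : ℝ) 3, Real.rpow_def_of_pos hn0]
    norm_num
  rw [h2, ← h3]
  exact exp_neg_min_le _ _

end PermSum

end

/-! ### Conclusion -/

theorem theorem4p3 (ε : ℝ) (hε : 0 < ε) (hε' : ε < 1 / 2) :
    ∃ A₀ : ℝ, 0 < A₀ ∧ ∀ A : ℝ, A₀ ≤ A →
      ∃ C : ℝ, 0 < C ∧ ∀ (n : ℕ) (w : Fin n → ℝ),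
        PermSum.NonDegenerate A w →
        PermSum.NoConcentration (ε / Real.sqrt n) ((1 - ε) * n) w →
        A * n * Real.log n ≤
          (PermSum.pairCount (1 / (n : ℝ) ^ (3 / 2 : ℝ)) (1 / (n : ℝ) ^ (3 / 2 - ε)) w : ℝ) →
        ∀ L : ℝ,
          PermSum.permProb n (fun π =>
            |PermSum.permSum w (PermSum.linearSeq n) π - L| ≤ 1 / (n : ℝ) ^ (5 / 2 - ε))
            ≤ C * (1 / (n : ℝ) ^ (5 / 2 - ε)) := by
  -- `92160 = 4 * 23040`: a matching of `m ≤ (23040/ε) log n` pairs needs `4mn` ordered pairs.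
  refine ⟨92160 / ε, by positivity, fun A hA => ?_⟩
  set c : ℝ := ε ^ 3 / 737280 with hcdef
  set a : ℝ := ε / 737280 with hadef
  have hc : 0 < c := by positivity
  have ha : 0 < a := by positivity
  -- `6 / a ^ 3` absorbs `exp(-an)` and `1` absorbs `n⁻³`, both through `T ≤ n³`.
  set B : ℝ := 6 / a ^ 3 + 1 with hBdef
  have hB : 0 < B := by positivity
  refine ⟨3 * (2 * Real.sqrt (Real.pi / c) + 4 * B), by positivity, ?_⟩
  intro n w hw hconc hpairs L
  have hn := hw.two_le
  have hn1 : (1 : ℝ) ≤ n := by exact_mod_cast (by omega : 1 ≤ n)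
  have hn0 : (0 : ℝ) < n := by linarith
  set T : ℝ := (n : ℝ) ^ (5 / 2 - ε) with hTdef
  have hT : 0 < T := by positivity
  have hTn : T ≤ (n : ℝ) ^ 3 := by
    rw [hTdef, ← Real.rpow_natCast]
    exact Real.rpow_le_rpow_of_exponent_le hn1 (by push_cast; linarith)
  have hinv : 1 / (n : ℝ) ^ 3 ≤ 1 / T := one_div_le_one_div_of_le hT hTn
  have hexp : Real.exp (-(a * n)) ≤ 6 / a ^ 3 / T :=
    (PermSum.exp_neg_mul_le ha hn0).trans (by gcongr)
  have hBT : B / T = 6 / a ^ 3 / T + 1 / T := by rw [hBdef, add_div]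
  have hT1 : 0 < 1 / T := by positivity
  have h := PermSum.card_near_le (PermSum.permSum w (PermSum.linearSeq n)) L
    (T := T) (N := n ! * 3) (c := c) (B := B) hT (by positivity) hc hB.le (by
      intro t ht htT
      rw [mul_assoc, neg_mul]
      -- The split is where `t` times the largest intermediate difference `2 / (√ε √n)` reaches `n`,
      -- the limit for a useful cosine bound.
      rcases le_total (t * (2 / √ε)) (n * √n) with h1 | h1
      · refine (PermSum.norm_sum_exp_le_of_le hε hε' hw hconc ht h1).trans ?_
        have h2 : Real.exp (-(ε / 46080 * n)) ≤ Real.exp (-(a * n)) := by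
          rw [Real.exp_le_exp, neg_le_neg_iff, hadef]
          gcongr
          norm_num
        gcongr
        linarith
      · refine (PermSum.norm_sum_exp_le_of_ge hε hε' hn hA hpairs htT h1).trans ?_
        have h2 : Real.exp (-(ε / 737280 * n)) = Real.exp (-(a * n)) := rfl
        have h3 : 1 / (n : ℝ) ^ 3 + Real.exp (-(ε / 737280 * n)) ≤
            Real.exp (-(c * t ^ 2)) + B / T := by
          linarith [Real.exp_pos (-(c * t ^ 2))]
        gcongr)
  unfold PermSum.permProb
  rw [div_le_iff₀ (by positivity)]
  refine h.trans (le_of_eq ?_)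
  ring
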